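/- Let $I,J$ be completely regular Hausdorff spaces such that $I\times J$ is pseudocompact (every continuous real-valued function on $I\times J$ is bounded), and let $X,Y$ be locally convex topological vector spaces over $\mathbb{C}$ (not necessarily Hausdorff). Let the algebraic tensor product $X\otimes Y$ carry any topology making it a locally convex topological vector space for which the canonical bilinear map $\otimes\colon X\times Y\to X\otimes Y$ is continuous (for example the $\varepsilon$- or the $\pi$-topology). Let $C(\Omega,Z)$ be the space of continuous functions $\Omega\to Z$ with the topology of uniform convergence, and $$\mathcal{K}C(\Omega,Z)=\{f\in C(\Omega,Z):\overline{f(\Omega)}\text{ is compact}\}$$ with the induced topology. For $f\colon I\to X$ and $g\colon J\to Y$ put $(f\otimes g)(s,t)=f(s)\otimes g(t)$, and for $W\subset C(I,X)$, $V\subset C(J,Y)$ put $W\otimes V=\operatorname{span}\{f\otimes g: f\in W,\ g\in V\}\subset C(I\times J,X\otimes Y)$. Then: (a) $\mathcal{K}C(I,X)\otimes\mathcal{K}C(J,Y)\subset\mathcal{K}C(I\times J,X\otimes Y)$, and $\mathcal{K}C(I\times J,X\otimes Y)=\overline{\mathcal{K}C(I,X)\otimes\mathcal{K}C(J,Y)}$,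 where the closure is taken in $\mathcal{K}C(I\times J,X\otimes Y)$ with the uniform topology. (b) If each of $X$ and $Y$ has the Heine–Borel property (every closed bounded subset is compact) or is metrizable (in the sense that $0$ has a countable neighbourhood base), then $C(I\times J,X\otimes Y)=\overline{C(I,X)\otimes C(J,Y)}$, where the closure is taken in $C(I\times J,X\otimes Y)$ with the uniform topology. -/

import Mathlib

open scoped TensorProduct Topology

/-- A topological space is pseudocompact if every continuous real-valued function on it is
bounded. -/
def IsPseudocompact (Ω : Type*) [TopologicalSpace Ω] : Prop :=
  ∀ f : C(Ω, ℝ), ∃ M : ℝ, ∀ t, |f t| ≤ M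

/-- A topological vector space is metrizable in the sense that it has a countable local base,
i.e. `0` has a countable neighbourhood base (the Hausdorff property is not part of this). -/
def HasCountableLocalBase (X : Type*) [Zero X] [TopologicalSpace X] : Prop :=
  (𝓝 (0 : X)).IsCountablyGenerated

/-- The uniform topology on `C(Ω, Z)`: the topology of uniform convergence on `Ω` with respect to
the canonical (translation-invariant) uniformity of the topological vector space `Z`. -/
@[reducible] def uniformTopology (Ω Z : Type*) [TopologicalSpace Ω] [AddCommGroup Z] [TopologicalSpace Z]
    [IsTopologicalAddGroup Z] : TopologicalSpace C(Ω, Z) :=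
  letI : UniformSpace Z := IsTopologicalAddGroup.rightUniformSpace Z
  TopologicalSpace.induced (fun f : C(Ω, Z) => UniformFun.ofFun (f : Ω → Z))
    (UniformFun.topologicalSpace Ω Z)

/-- `𝒦C(Ω, Z)`: the continuous functions whose range has compact closure. -/
def compactRangeMaps (Ω Z : Type*) [TopologicalSpace Ω] [TopologicalSpace Z] : Set C(Ω, Z) :=
  {f | IsCompact (closure (Set.range f))}

section Tensor

variable {I J X Y : Type*} [TopologicalSpace I] [TopologicalSpace J]
  [AddCommGroup X] [Module ℂ X] [TopologicalSpace X]
  [AddCommGroup Y] [Module ℂ Y] [TopologicalSpace Y] [TopologicalSpace (X ⊗[ℂ] Y)]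

/-- `f ⊗ g : I × J → X ⊗ Y`, `(s, t) ↦ f s ⊗ g t`. -/
def tensorMap (hc : Continuous fun z : X × Y => z.1 ⊗ₜ[ℂ] z.2) (f : C(I, X)) (g : C(J, Y)) :
    C(I × J, X ⊗[ℂ] Y) where
  toFun p := f p.1 ⊗ₜ[ℂ] g p.2
  continuous_toFun :=
    hc.comp ((f.continuous.comp continuous_fst).prodMk (g.continuous.comp continuous_snd))

/-- `W ⊗ V`: the complex linear span of the functions `f ⊗ g` with `f ∈ W`, `g ∈ V`. -/
def tensorSpan [IsTopologicalAddGroup (X ⊗[ℂ] Y)] [ContinuousSMul ℂ (X ⊗[ℂ] Y)]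
    (hc : Continuous fun z : X × Y => z.1 ⊗ₜ[ℂ] z.2) (W : Set C(I, X)) (V : Set C(J, Y)) :
    Submodule ℂ C(I × J, X ⊗[ℂ] Y) :=
  Submodule.span ℂ (Set.image2 (tensorMap hc) W V)

end Tensor

open Set Filter BoundedContinuousFunction

/-! ### Completely regular pseudocompact spaces -/

section Pseudocompact

variable {Ω : Type*} [TopologicalSpace Ω]

/-! Fix a continuous seminorm on `X ⊗ Y`. Pseudocompactness of `I × J` makes `s ↦ f (s, ·)`
continuous for the sup norm (`eventually_forall_dist_lt`), and makes pseudometric images totally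
bounded (`totallyBounded_range`). Partitions of unity pulled back from such images, first in `s` and
then in `t`, approximate `f` by finite sums of `a s • b t • z`. Splitting `z` into elementary
tensors turns these into sums of `(a s • x) ⊗ (b t • y)`, whose factors have relatively compact
range because `a` and `b` are bounded. This single density statement, `mem_closure_tensorSpan`,
yields both (a) and (b). -/

theorem IsPseudocompact.of_surjective {Ω' : Type*} [TopologicalSpace Ω'] (hΩ : IsPseudocompact Ω)
    {q : Ω → Ω'} (hq : Continuous q) (hs : Function.Surjective q) : IsPseudocompact Ω' := by
  intro f
  obtain ⟨M, hM⟩ := hΩ (f.comp ⟨q, hq⟩)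
  refine ⟨M, fun t => ?_⟩
  obtain ⟨x, rfl⟩ := hs t
  exact hM x

/-- In a completely regular pseudocompact space, a sequence of nonempty open sets is never locally
finite. -/
theorem IsPseudocompact.not_locallyFinite [CompletelyRegularSpace Ω] (hΩ : IsPseudocompact Ω)
    {O : ℕ → Set Ω} (hO : ∀ n, IsOpen (O n)) (hne : ∀ n, (O n).Nonempty) : ¬ LocallyFinite O := by
  intro hlf
  choose x hx using hne
  have h : ∀ n, ∃ u : Ω → unitInterval, Continuous u ∧ u (x n) = 0 ∧ EqOn u 1 (O n)ᶜ := fun n =>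
    CompletelyRegularSpace.completely_regular (x n) (O n)ᶜ (hO n).isClosed_compl (by simpa using hx n)
  choose u hu hu0 hu1 using h
  -- A bump of height `n` at `x n`, supported in `O n`. Local finiteness would make the sum of the
  -- bumps continuous, yet it is unbounded.
  let v : ℕ → Ω → ℝ := fun n t => n * (1 - (u n t : ℝ))
  have hv : ∀ n, Continuous (v n) := fun n =>
    continuous_const.mul (continuous_const.sub (continuous_subtype_val.comp (hu n)))
  have hv0 : ∀ n t, 0 ≤ v n t := fun n t =>
    mul_nonneg n.cast_nonneg (sub_nonneg.2 (u n t).2.2)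
  have hsupp : ∀ n, Function.support (v n) ⊆ O n := by
    intro n t ht
    by_contra hto
    exact ht (by simp [v, hu1 n hto])
  have hlf' : LocallyFinite fun n => Function.support (v n) := hlf.subset hsupp
  obtain ⟨M, hM⟩ := hΩ ⟨fun t => ∑ᶠ n, v n t, continuous_finsum hv hlf'⟩
  obtain ⟨n, hn⟩ := exists_nat_gt M
  have h1 : v n (x n) ≤ ∑ᶠ k, v k (x n) :=
    single_le_finsum n (hlf'.point_finite (x n)) fun k => hv0 k _
  have h2 := (le_abs_self _).trans (hM (x n))
  have h3 : v n (x n) = n := by simp [v, hu0]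
  simp only [ContinuousMap.coe_mk] at h2
  linarith

/-- In a completely regular pseudocompact space, every sequence of nonempty open sets has a cluster
point, all of whose neighbourhoods meet two members of the sequence. -/
theorem IsPseudocompact.exists_cluster [CompletelyRegularSpace Ω] (hΩ : IsPseudocompact Ω)
    {O : ℕ → Set Ω} (hO : ∀ n, IsOpen (O n)) (hne : ∀ n, (O n).Nonempty) :
    ∃ x, ∀ U ∈ 𝓝 x, ∃ m n, m < n ∧ (O m ∩ U).Nonempty ∧ (O n ∩ U).Nonempty := by
  have h := hΩ.not_locallyFinite hO hne
  simp only [LocallyFinite, not_forall, not_exists, not_and] at h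
  obtain ⟨x, hx⟩ := h
  refine ⟨x, fun U hU => ?_⟩
  have hinf : Set.Infinite {i | (O i ∩ U).Nonempty} := hx U hU
  obtain ⟨m, hm⟩ := hinf.nonempty
  obtain ⟨n, hn, hmn⟩ := hinf.exists_gt m
  exact ⟨m, n, hmn, hm, hn⟩

/-- A continuous image of a completely regular pseudocompact space in a pseudometric space is
totally bounded. -/
theorem IsPseudocompact.totallyBounded_range [CompletelyRegularSpace Ω] (hΩ : IsPseudocompact Ω)
    {M : Type*} [PseudoMetricSpace M] {u : Ω → M} (hu : Continuous u) {ε : ℝ} (hε : 0 < ε) :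
    ∃ t : Finset Ω, ∀ s, ∃ y ∈ t, dist (u s) (u y) < ε := by
  -- Failure gives an `ε`-separated sequence of values. Near a cluster point of the preimages of
  -- their `ε / 4`-balls, two of these values are joined by four steps shorter than `ε / 4`.
  by_contra! hcon
  obtain ⟨x, -, hx⟩ := exists_seq_of_forall_finset_exists (fun _ : Ω => True)
    (fun a b => ε ≤ dist (u b) (u a)) fun t _ => by
      obtain ⟨s, hs⟩ := hcon t
      exact ⟨s, trivial, hs⟩
  obtain ⟨z, hz⟩ := hΩ.exists_cluster (O := fun n => u ⁻¹' Metric.ball (u (x n)) (ε / 4))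
    (fun n => Metric.isOpen_ball.preimage hu) fun n => ⟨x n, by simpa using hε⟩
  obtain ⟨m, n, hmn, ⟨a, ham, haz⟩, ⟨b, hbn, hbz⟩⟩ :=
    hz (u ⁻¹' Metric.ball (u z) (ε / 4)) (hu.continuousAt (Metric.ball_mem_nhds _ (by positivity)))
  have h := hx m n hmn
  simp only [mem_preimage, Metric.mem_ball] at ham haz hbn hbz
  have h1 := dist_triangle4 (u (x n)) (u b) (u z) (u a)
  have h2 := dist_triangle (u (x n)) (u a) (u (x m))
  have h3 := dist_comm (u b) (u (x n))
  have h4 := dist_comm (u a) (u z)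
  linarith

/-- A continuous map from a completely regular pseudocompact space to a seminormed space is
uniformly approximated by combinations of vectors with a partition of unity as coefficients. -/
theorem IsPseudocompact.exists_partition_approx [CompletelyRegularSpace Ω]
    (hΩ : IsPseudocompact Ω) {E : Type*} [SeminormedAddCommGroup E] [NormedSpace ℂ E] {u : Ω → E}
    (hu : Continuous u) {ε : ℝ} (hε : 0 < ε) :
    ∃ (t : Finset Ω) (φ : Ω → C(Ω, ℝ)), (∀ y s, 0 ≤ φ y s) ∧ (∀ s, ∑ y ∈ t, φ y s = 1) ∧
      ∀ s, ‖u s - ∑ y ∈ t, (φ y s : ℂ) • u y‖ ≤ ε := by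
  obtain ⟨t, ht⟩ := hΩ.totallyBounded_range hu hε
  -- The weight of `y` vanishes once `u s` is `ε` away from `u y`, so only vectors within `ε` of `u
  -- s` enter the convex combination.
  let ψ : Ω → Ω → ℝ := fun y s => max 0 (ε - dist (u s) (u y))
  have hψ : ∀ y, Continuous (ψ y) := fun y =>
    continuous_const.max (continuous_const.sub (hu.dist continuous_const))
  have hψ0 : ∀ y s, 0 ≤ ψ y s := fun y s => le_max_left _ _
  have hS : ∀ s, 0 < ∑ y ∈ t, ψ y s := by
    intro s
    obtain ⟨y, hy, hys⟩ := ht s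
    exact Finset.sum_pos' (fun y _ => hψ0 y s) ⟨y, hy, lt_max_of_lt_right (sub_pos.2 hys)⟩
  let φ : Ω → C(Ω, ℝ) := fun y => ⟨fun s => ψ y s / ∑ z ∈ t, ψ z s,
    (hψ y).div (continuous_finsetSum t fun z _ => hψ z) fun s => (hS s).ne'⟩
  have hφ0 : ∀ y s, 0 ≤ φ y s := fun y s => div_nonneg (hψ0 y s) (hS s).le
  have hφ1 : ∀ s, ∑ y ∈ t, φ y s = 1 := by
    intro s
    change ∑ y ∈ t, ψ y s / ∑ z ∈ t, ψ z s = 1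
    rw [← Finset.sum_div, div_self (hS s).ne']
  refine ⟨t, φ, hφ0, hφ1, fun s => ?_⟩
  have h1 : u s - ∑ y ∈ t, (φ y s : ℂ) • u y = ∑ y ∈ t, (φ y s : ℂ) • (u s - u y) := by
    simp only [smul_sub, Finset.sum_sub_distrib, ← Finset.sum_smul]
    rw [← Complex.ofReal_sum, hφ1, Complex.ofReal_one, one_smul]
  rw [h1]
  calc ‖∑ y ∈ t, (φ y s : ℂ) • (u s - u y)‖ ≤ ∑ y ∈ t, φ y s * ε := by
        refine norm_sum_le_of_le t fun y _ => ?_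
        rw [norm_smul, Complex.norm_real, Real.norm_of_nonneg (hφ0 y s)]
        by_cases hd : dist (u s) (u y) ≤ ε
        · rw [← dist_eq_norm]
          exact mul_le_mul_of_nonneg_left hd (hφ0 y s)
        · have : φ y s = 0 := by
            change ψ y s / _ = 0
            rw [show ψ y s = 0 from max_eq_left (by linarith), zero_div]
          simp [this]
    _ = ε := by rw [← Finset.sum_mul, hφ1, one_mul]

end Pseudocompact

/-! ### Separating the variables on a pseudocompact product -/

section Product

variable {I J : Type*} [TopologicalSpace I] [TopologicalSpace J]

/-- If `I × J` is completely regular and pseudocompact, then a continuous map on `I × J` is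
continuous in the first variable, uniformly in the second. -/
theorem IsPseudocompact.eventually_forall_dist_lt [CompletelyRegularSpace (I × J)]
    (hIJ : IsPseudocompact (I × J)) {M : Type*} [PseudoMetricSpace M] {f : I × J → M}
    (hf : Continuous f) (s₀ : I) {ε : ℝ} (hε : 0 < ε) :
    ∀ᶠ s in 𝓝 s₀, ∀ t, dist (f (s, t)) (f (s₀, t)) < ε := by
  set g : I × J → ℝ := fun p => dist (f p) (f (s₀, p.2)) with hgdef
  have hg : Continuous g := hf.dist (hf.comp (continuous_const.prodMk continuous_snd))
  by_contra hcon
  have hfreq : ∀ W ∈ 𝓝 s₀, ∃ s ∈ W, ∃ t, ε ≤ g (s, t) := by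
    intro W hW
    by_contra! hno
    exact hcon (mem_of_superset hW fun s hs t => hno s hs t)
  -- Triples `(A, B, W)`: `g` is large on `A × B` and small on `W × B`, with `W` a neighbourhood of
  -- `s₀`. Each later `A` lies in every earlier `W`.
  obtain ⟨x, hxP, hxr⟩ := exists_seq_of_forall_finset_exists
    (fun x : Set I × Set J × Set I => IsOpen x.1 ∧ IsOpen x.2.1 ∧ x.1.Nonempty ∧ x.2.1.Nonempty ∧
      x.2.2 ∈ 𝓝 s₀ ∧ (∀ p ∈ x.1 ×ˢ x.2.1, ε / 2 < g p) ∧ ∀ p ∈ x.2.2 ×ˢ x.2.1, g p < ε / 4)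
    (fun x y => y.1 ⊆ x.2.2) fun F hF => by
      have hW : (⋂ x ∈ F, interior x.2.2) ∈ 𝓝 s₀ :=
        (biInter_finset_mem F).2 fun x hx => interior_mem_nhds.2 (hF x hx).2.2.2.2.1
      have hWo : IsOpen (⋂ x ∈ F, interior x.2.2) :=
        isOpen_biInter_finset fun x _ => isOpen_interior
      obtain ⟨s, hs, t, hst⟩ := hfreq _ hW
      have h1 : {p | ε / 2 < g p} ∈ 𝓝 (s, t) :=
        (isOpen_lt continuous_const hg).mem_nhds (by change ε / 2 < g (s, t); linarith)
      have h2 : {p | g p < ε / 4} ∈ 𝓝 (s₀, t) :=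
        (isOpen_lt hg continuous_const).mem_nhds (by simpa [hgdef] using hε)
      obtain ⟨A, B, hA, hsA, hB, htB, hAB⟩ := mem_nhds_prod_iff'.1 h1
      obtain ⟨W, B', hW', hsW, hB', htB', hWB⟩ := mem_nhds_prod_iff'.1 h2
      refine ⟨(A ∩ ⋂ x ∈ F, interior x.2.2, B ∩ B', W), ⟨hA.inter hWo, hB.inter hB', ⟨s, hsA, hs⟩,
        ⟨t, htB, htB'⟩, hW'.mem_nhds hsW, fun p hp => hAB ⟨hp.1.1, hp.2.1⟩,
        fun p hp => hWB ⟨hp.1, hp.2.2⟩⟩, fun y hy z hz => ?_⟩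
      exact interior_subset (mem_iInter₂.1 hz.2 y hy)
  obtain ⟨⟨s, t⟩, hst⟩ := hIJ.exists_cluster (O := fun n => (x n).1 ×ˢ (x n).2.1)
    (fun n => (hxP n).1.prod (hxP n).2.1) fun n => (hxP n).2.2.1.prod (hxP n).2.2.2.1
  have hN : {p | dist (g p) (g (s, t)) < ε / 8} ∈ 𝓝 (s, t) :=
    hg.continuousAt (Metric.ball_mem_nhds _ (by positivity))
  obtain ⟨A, B, hA, hsA, hB, htB, hAB⟩ := mem_nhds_prod_iff'.1 hN
  obtain ⟨m, n, hmn, ⟨⟨a, b⟩, hab, hab'⟩, ⟨⟨c, d⟩, hcd, hcd'⟩⟩ :=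
    hst (A ×ˢ B) ((hA.prod hB).mem_nhds ⟨hsA, htB⟩)
  -- The mixed point `(c, b)` also lies in the box `A × B`. Since `c` is in the earlier `W`, `g` is
  -- small there but large at `(a, b)`, a gap exceeding `ε / 4`.
  have h1 : dist (g (a, b)) (g (s, t)) < ε / 8 := hAB hab'
  have h2 : dist (g (c, b)) (g (s, t)) < ε / 8 := hAB ⟨hcd'.1, hab'.2⟩
  have h3 : ε / 2 < g (a, b) := (hxP m).2.2.2.2.2.1 _ hab
  have h4 : g (c, b) < ε / 4 := (hxP m).2.2.2.2.2.2 _ ⟨hxr m n hmn hcd.1, hab.2⟩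
  rw [Real.dist_eq, abs_lt] at h1 h2
  linarith [h1.1, h1.2, h2.1, h2.2]

/-- If `I × J` is completely regular and pseudocompact, then every continuous map from `I × J` to a
seminormed space is uniformly approximated by finite sums of maps `(s, t) ↦ a s • b t • e`. -/
theorem IsPseudocompact.exists_separated_approx [CompletelyRegularSpace I]
    [CompletelyRegularSpace J] (hIJ : IsPseudocompact (I × J)) {E : Type*}
    [SeminormedAddCommGroup E] [NormedSpace ℂ E] {f : I × J → E} (hf : Continuous f) {ε : ℝ}
    (hε : 0 < ε) :
    ∃ h ∈ Submodule.span ℂ {h : I × J → E | ∃ (a : C(I, ℝ)) (b : C(J, ℝ)) (e : E),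
        h = fun p => (a p.1 : ℂ) • (b p.2 : ℂ) • e}, ∀ p, ‖h p - f p‖ ≤ ε := by
  -- The factors inherit pseudocompactness only through surjective projections, which need a point
  -- in each factor.
  rcases isEmpty_or_nonempty (I × J) with hem | ⟨⟨s₀, t₀⟩⟩
  · exact ⟨0, Submodule.zero_mem _, fun p => hem.elim p⟩
  have hI : IsPseudocompact I := hIJ.of_surjective continuous_fst fun s => ⟨(s, t₀), rfl⟩
  have hJ : IsPseudocompact J := hIJ.of_surjective continuous_snd fun t => ⟨(s₀, t), rfl⟩
  obtain ⟨M, hM⟩ := hIJ ⟨fun p => ‖f p‖, hf.norm⟩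
  have hM' : ∀ p, ‖f p‖ ≤ M := fun p => (le_abs_self _).trans (hM p)
  let u : I → J →ᵇ E := fun s => BoundedContinuousFunction.ofNormedAddCommGroup
    (fun t => f (s, t)) (hf.comp (continuous_const.prodMk continuous_id)) M fun t => hM' _
  have hu : Continuous u := by
    refine continuous_iff_continuousAt.2 fun s => Metric.tendsto_nhds.2 fun δ hδ => ?_
    filter_upwards [hIJ.eventually_forall_dist_lt hf s (half_pos hδ)] with s' hs'
    exact ((BoundedContinuousFunction.dist_le (half_pos hδ).le).2 fun t => (hs' t).le).trans_lt
      (half_lt_self hδ)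
  obtain ⟨F, φ, hφ0, hφ1, hφ⟩ := hI.exists_partition_approx hu (half_pos hε)
  have hJa : ∀ y : I, ∃ (G : Finset J) (ψ : J → C(J, ℝ)),
      ∀ t, ‖f (y, t) - ∑ z ∈ G, (ψ z t : ℂ) • f (y, z)‖ ≤ ε / 2 := by
    intro y
    obtain ⟨G, ψ, -, -, hψ⟩ := hJ.exists_partition_approx
      (hf.comp (continuous_const.prodMk continuous_id : Continuous fun t : J => (y, t)))
      (half_pos hε)
    exact ⟨G, ψ, hψ⟩
  choose G ψ hψ using hJa
  refine ⟨∑ y ∈ F, ∑ z ∈ G y, fun p => (φ y p.1 : ℂ) • (ψ y z p.2 : ℂ) • f (y, z),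
    Submodule.sum_mem _ fun y _ => Submodule.sum_mem _ fun z _ =>
      Submodule.subset_span ⟨φ y, ψ y z, f (y, z), rfl⟩, ?_⟩
  rintro ⟨s, t⟩
  have h1 : ‖f (s, t) - ∑ y ∈ F, (φ y s : ℂ) • f (y, t)‖ ≤ ε / 2 := by
    have := ((u s - ∑ y ∈ F, (φ y s : ℂ) • u y).norm_coe_le_norm t).trans (hφ s)
    simpa [u, BoundedContinuousFunction.sum_apply] using this
  have h2 : ‖∑ y ∈ F, (φ y s : ℂ) • (f (y, t) - ∑ z ∈ G y, (ψ y z t : ℂ) • f (y, z))‖ ≤ ε / 2 := by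
    calc _ ≤ ∑ y ∈ F, φ y s * (ε / 2) := by
          refine norm_sum_le_of_le F fun y _ => ?_
          rw [norm_smul, Complex.norm_real, Real.norm_of_nonneg (hφ0 y s)]
          exact mul_le_mul_of_nonneg_left (hψ y t) (hφ0 y s)
      _ = ε / 2 := by rw [← Finset.sum_mul, hφ1, one_mul]
  rw [norm_sub_rev]
  -- The error splits into that of the partition in `s` and a convex combination of those in `t`.
  have h3 : f (s, t) - (∑ y ∈ F, ∑ z ∈ G y,
      fun p : I × J => (φ y p.1 : ℂ) • (ψ y z p.2 : ℂ) • f (y, z)) (s, t) =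
      (f (s, t) - ∑ y ∈ F, (φ y s : ℂ) • f (y, t)) +
      ∑ y ∈ F, (φ y s : ℂ) • (f (y, t) - ∑ z ∈ G y, (ψ y z t : ℂ) • f (y, z)) := by
    simp only [Finset.sum_apply, smul_sub, Finset.smul_sum, Finset.sum_sub_distrib]
    abel
  rw [h3]
  linarith [norm_add_le (f (s, t) - ∑ y ∈ F, (φ y s : ℂ) • f (y, t))
    (∑ y ∈ F, (φ y s : ℂ) • (f (y, t) - ∑ z ∈ G y, (ψ y z t : ℂ) • f (y, z)))]

/-- A version of `IsPseudocompact.exists_separated_approx` for a seminorm on a vector space. -/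
theorem IsPseudocompact.exists_separated_approx_seminorm [CompletelyRegularSpace I]
    [CompletelyRegularSpace J] (hIJ : IsPseudocompact (I × J)) {E : Type*}
    [AddCommGroup E] [Module ℂ E] (p : Seminorm ℂ E) {f : I × J → E}
    (hf : ∀ x, Tendsto (fun y => p (f y - f x)) (𝓝 x) (𝓝 0)) {ε : ℝ} (hε : 0 < ε) :
    ∃ h ∈ Submodule.span ℂ {h : I × J → E | ∃ (a : C(I, ℝ)) (b : C(J, ℝ)) (e : E),
        h = fun p => (a p.1 : ℂ) • (b p.2 : ℂ) • e}, ∀ x, p (h x - f x) ≤ ε := by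
  let _ : SeminormedAddCommGroup E := p.toSeminormedAddCommGroup
  let _ : NormedSpace ℂ E := { norm_smul_le := fun a b => le_of_eq (map_smul_eq_mul p a b) }
  exact hIJ.exists_separated_approx (f := f)
    (continuous_iff_continuousAt.2 fun x => tendsto_iff_norm_sub_tendsto_zero.2 (hf x)) hε

end Product

/-! ### Seminorm criterion for uniform closure -/

section UniformTopology

variable {Ω Z : Type*} [TopologicalSpace Ω] [AddCommGroup Z] [Module ℂ Z] [TopologicalSpace Z]
  [IsTopologicalAddGroup Z] [PolynormableSpace ℂ Z]

/-- A set of continuous maps is dense at `f` for the uniform topology as soon as it approximates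
`f` uniformly with respect to every continuous seminorm. -/
theorem mem_closure_uniformTopology {S : Set C(Ω, Z)} {f : C(Ω, Z)}
    (H : ∀ p : Seminorm ℂ Z, Continuous p → ∀ ε > 0, ∃ h ∈ S, ∀ x, p (h x - f x) ≤ ε) :
    f ∈ closure[uniformTopology Ω Z] S := by
  let _ : UniformSpace Z := IsTopologicalAddGroup.rightUniformSpace Z
  let _ : TopologicalSpace C(Ω, Z) := uniformTopology Ω Z
  rw [mem_closure_iff_nhds]
  intro U hU
  rw [nhds_induced, mem_comap] at hU
  obtain ⟨V, hV, hVU⟩ := hU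
  obtain ⟨T, hT, hTV⟩ := (UniformFun.hasBasis_nhds Ω Z _).mem_iff.1 hV
  obtain ⟨N, hN, hNT⟩ := mem_comap.1 hT
  obtain ⟨⟨q, ε⟩, hε, hq⟩ :=
    (PolynormableSpace.withSeminorms ℂ Z).hasBasis_zero_ball.mem_iff.1 hN
  have hε' : 0 < ε := hε
  have hqc : Continuous (q.sup (fun p : {p : Seminorm ℂ Z // Continuous p} => p.1) : Seminorm ℂ Z) := by
    classical
    clear hq hε hε'
    induction q using Finset.induction_on with
    | empty => exact continuous_const
    | insert a q _ ih =>
      rw [Finset.sup_insert]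
      exact a.2.max ih
  obtain ⟨h, hS, hh⟩ := H _ hqc (ε / 2) (half_pos hε)
  refine ⟨h, hVU (hTV fun x => hNT (hq ?_)), hS⟩
  rw [Seminorm.mem_ball_zero]
  have := hh x
  rw [sub_eq_add_neg] at this
  exact this.trans_lt (half_lt_self hε')

end UniformTopology

/-! ### Maps with relatively compact range -/

section CompactRange

variable {Ω Z : Type*} [TopologicalSpace Ω] [AddCommGroup Z] [Module ℂ Z] [TopologicalSpace Z]
  [IsTopologicalAddGroup Z] [ContinuousSMul ℂ Z]

/-- The continuous maps with relatively compact range, as a linear subspace. -/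
def compactRangeSubmodule (Ω Z : Type*) [TopologicalSpace Ω] [AddCommGroup Z] [Module ℂ Z]
    [TopologicalSpace Z] [IsTopologicalAddGroup Z] [ContinuousSMul ℂ Z] :
    Submodule ℂ C(Ω, Z) where
  carrier := compactRangeMaps Ω Z
  zero_mem' := (isCompact_singleton (x := (0 : Z))).closure_of_subset <| by
    rintro _ ⟨x, rfl⟩
    rfl
  add_mem' {f g} hf hg := (IsCompact.add hf hg).closure_of_subset <| by
    rintro _ ⟨x, rfl⟩
    exact Set.add_mem_add (subset_closure ⟨x, rfl⟩) (subset_closure ⟨x, rfl⟩)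
  smul_mem' c f hf := (IsCompact.image hf (continuous_const_smul c)).closure_of_subset <| by
    rintro _ ⟨x, rfl⟩
    exact ⟨f x, subset_closure ⟨x, rfl⟩, rfl⟩

/-- The map `s ↦ a s • z`. -/
def smulVector (a : C(Ω, ℝ)) (z : Z) : C(Ω, Z) where
  toFun s := (a s : ℂ) • z
  continuous_toFun := (Complex.continuous_ofReal.comp a.continuous).smul continuous_const

/-- As `a` is bounded, the range lies in the image of a compact disc under `c ↦ c • z`. -/
theorem IsPseudocompact.smulVector_mem (hΩ : IsPseudocompact Ω) (a : C(Ω, ℝ)) (z : Z) :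
    smulVector a z ∈ compactRangeMaps Ω Z := by
  obtain ⟨M, hM⟩ := hΩ a
  refine IsCompact.closure_of_subset ((isCompact_closedBall (0 : ℂ) M).image
    (f := fun c : ℂ => c • z) (continuous_id.smul continuous_const)) ?_
  rintro _ ⟨s, rfl⟩
  exact ⟨a s, by simpa using hM s, rfl⟩

end CompactRange

/-! ### Density of the tensor product -/

section Density

variable {I J X Y : Type*} [TopologicalSpace I] [TopologicalSpace J]
  [AddCommGroup X] [Module ℂ X] [TopologicalSpace X] [IsTopologicalAddGroup X] [ContinuousSMul ℂ X]
  [AddCommGroup Y] [Module ℂ Y] [TopologicalSpace Y] [IsTopologicalAddGroup Y] [ContinuousSMul ℂ Y]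
  [TopologicalSpace (X ⊗[ℂ] Y)] [IsTopologicalAddGroup (X ⊗[ℂ] Y)] [ContinuousSMul ℂ (X ⊗[ℂ] Y)]

omit [IsTopologicalAddGroup X] [ContinuousSMul ℂ X] [IsTopologicalAddGroup Y]
  [ContinuousSMul ℂ Y] in
theorem tensorSpan_compactRangeMaps_subset (hc : Continuous fun z : X × Y => z.1 ⊗ₜ[ℂ] z.2) :
    (tensorSpan hc (compactRangeMaps I X) (compactRangeMaps J Y) : Set C(I × J, X ⊗[ℂ] Y)) ⊆
      compactRangeMaps (I × J) (X ⊗[ℂ] Y) := by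
  change tensorSpan hc _ _ ≤ compactRangeSubmodule (I × J) (X ⊗[ℂ] Y)
  refine Submodule.span_le.2 ?_
  rintro _ ⟨f, hf, g, hg, rfl⟩
  refine IsCompact.closure_of_subset ((IsCompact.prod hf hg).image hc) ?_
  rintro _ ⟨p, rfl⟩
  exact ⟨(f p.1, g p.2), ⟨subset_closure ⟨_, rfl⟩, subset_closure ⟨_, rfl⟩⟩, rfl⟩

/-- For an elementary tensor the scalars distribute over the two factors; sums follow by induction
on `z`. -/
theorem exists_mem_tensorSpan_eq (hc : Continuous fun z : X × Y => z.1 ⊗ₜ[ℂ] z.2)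
    (hI : IsPseudocompact I) (hJ : IsPseudocompact J) (a : C(I, ℝ)) (b : C(J, ℝ))
    (z : X ⊗[ℂ] Y) :
    ∃ h ∈ tensorSpan hc (compactRangeMaps I X) (compactRangeMaps J Y),
      ∀ p, h p = (a p.1 : ℂ) • (b p.2 : ℂ) • z := by
  induction z using TensorProduct.induction_on with
  | zero => exact ⟨0, Submodule.zero_mem _, fun p => by simp⟩
  | tmul x y =>
    refine ⟨tensorMap hc (smulVector a x) (smulVector b y), Submodule.subset_span
      ⟨_, hI.smulVector_mem a x, _, hJ.smulVector_mem b y, rfl⟩, fun p => ?_⟩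
    change ((a p.1 : ℂ) • x) ⊗ₜ[ℂ] ((b p.2 : ℂ) • y) = _
    rw [TensorProduct.smul_tmul_smul, mul_smul]
  | add z w hz hw =>
    obtain ⟨h, hh, hz⟩ := hz
    obtain ⟨k, hk, hw⟩ := hw
    exact ⟨h + k, Submodule.add_mem _ hh hk, fun p => by simp [hz, hw]⟩

/-- The algebraic tensor product of the spaces of maps with relatively compact range is uniformly
dense in all continuous maps on a pseudocompact product. -/
theorem IsPseudocompact.mem_closure_tensorSpan [CompletelyRegularSpace I]
    [CompletelyRegularSpace J] [PolynormableSpace ℂ (X ⊗[ℂ] Y)]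
    (hc : Continuous fun z : X × Y => z.1 ⊗ₜ[ℂ] z.2) (hIJ : IsPseudocompact (I × J))
    (f : C(I × J, X ⊗[ℂ] Y)) :
    f ∈ closure[uniformTopology (I × J) (X ⊗[ℂ] Y)]
      (tensorSpan hc (compactRangeMaps I X) (compactRangeMaps J Y) :
        Set C(I × J, X ⊗[ℂ] Y)) := by
  refine mem_closure_uniformTopology fun p hp ε hε => ?_
  rcases isEmpty_or_nonempty (I × J) with hem | ⟨⟨s₀, t₀⟩⟩
  · exact ⟨0, Submodule.zero_mem _, fun x => hem.elim x⟩
  have hI : IsPseudocompact I := hIJ.of_surjective continuous_fst fun s => ⟨(s, t₀), rfl⟩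
  have hJ : IsPseudocompact J := hIJ.of_surjective continuous_snd fun t => ⟨(s₀, t), rfl⟩
  have hfp : ∀ x, Tendsto (fun y => p (f y - f x)) (𝓝 x) (𝓝 0) := by
    intro x
    have : Continuous fun y => p (f y - f x) := hp.comp (f.continuous.sub continuous_const)
    simpa using this.tendsto x
  obtain ⟨h, hh, hhf⟩ : ∃ h ∈ Submodule.span ℂ {h : I × J → X ⊗[ℂ] Y |
      ∃ (a : C(I, ℝ)) (b : C(J, ℝ)) (e : X ⊗[ℂ] Y),
        h = fun p => (a p.1 : ℂ) • (b p.2 : ℂ) • e}, ∀ x, p (h x - f x) ≤ ε :=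
    hIJ.exists_separated_approx_seminorm p hfp hε
  -- The approximant is so far a bare function; span induction lifts it to a continuous map in the
  -- tensor span.
  suffices hs : ∃ k ∈ tensorSpan hc (compactRangeMaps I X) (compactRangeMaps J Y), ⇑k = h by
    obtain ⟨k, hk, rfl⟩ := hs
    exact ⟨k, hk, hhf⟩
  clear hhf
  induction hh using Submodule.span_induction with
  | mem h hh =>
    obtain ⟨a, b, e, rfl⟩ := hh
    obtain ⟨k, hk, hke⟩ := exists_mem_tensorSpan_eq hc hI hJ a b e
    exact ⟨k, hk, funext hke⟩
  | zero => exact ⟨0, Submodule.zero_mem _, rfl⟩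
  | add h k _ _ ih ik =>
    obtain ⟨h, hh, rfl⟩ := ih
    obtain ⟨k, hk, rfl⟩ := ik
    exact ⟨h + k, Submodule.add_mem _ hh hk, rfl⟩
  | smul c h _ ih =>
    obtain ⟨h, hh, rfl⟩ := ih
    exact ⟨c • h, Submodule.smul_mem _ c hh, rfl⟩

end Density

theorem mainTheorem7
    {I J X Y : Type*}
    [TopologicalSpace I] [T35Space I] [TopologicalSpace J] [T35Space J]
    [AddCommGroup X] [Module ℂ X] [TopologicalSpace X] [IsTopologicalAddGroup X]
    [ContinuousSMul ℂ X] [PolynormableSpace ℂ X]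
    [AddCommGroup Y] [Module ℂ Y] [TopologicalSpace Y] [IsTopologicalAddGroup Y]
    [ContinuousSMul ℂ Y] [PolynormableSpace ℂ Y]
    [TopologicalSpace (X ⊗[ℂ] Y)] [IsTopologicalAddGroup (X ⊗[ℂ] Y)]
    [ContinuousSMul ℂ (X ⊗[ℂ] Y)] [PolynormableSpace ℂ (X ⊗[ℂ] Y)]
    (hc : Continuous fun z : X × Y => z.1 ⊗ₜ[ℂ] z.2)
    (hIJ : IsPseudocompact (I × J)) :
    -- (a) the closure is taken in the space `𝒦C(I × J, X ⊗ Y)` with the uniform topology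
    ((tensorSpan hc (compactRangeMaps I X) (compactRangeMaps J Y) : Set C(I × J, X ⊗[ℂ] Y)) ⊆
        compactRangeMaps (I × J) (X ⊗[ℂ] Y) ∧
      compactRangeMaps (I × J) (X ⊗[ℂ] Y) =
        closure[uniformTopology (I × J) (X ⊗[ℂ] Y)]
          (tensorSpan hc (compactRangeMaps I X) (compactRangeMaps J Y) :
            Set C(I × J, X ⊗[ℂ] Y)) ∩
          compactRangeMaps (I × J) (X ⊗[ℂ] Y)) ∧
    -- (b) the closure is taken in `C(I × J, X ⊗ Y)` with the uniform topology
    ((MontelSpace ℂ X ∨ HasCountableLocalBase X) → (MontelSpace ℂ Y ∨ HasCountableLocalBase Y) →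
      (Set.univ : Set C(I × J, X ⊗[ℂ] Y)) =
        closure[uniformTopology (I × J) (X ⊗[ℂ] Y)]
          (tensorSpan hc (Set.univ : Set C(I, X)) (Set.univ : Set C(J, Y)) :
            Set C(I × J, X ⊗[ℂ] Y))) := by
  refine ⟨⟨tensorSpan_compactRangeMaps_subset hc, ?_⟩, fun _ _ => ?_⟩
  · exact (inter_eq_right.2 fun f _ => hIJ.mem_closure_tensorSpan hc f).symm
  · refine (eq_univ_of_forall fun f => ?_).symm
    let _ : TopologicalSpace C(I × J, X ⊗[ℂ] Y) := uniformTopology (I × J) (X ⊗[ℂ] Y)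
    exact closure_mono (Submodule.span_mono (image2_subset (subset_univ _) (subset_univ _)))
      (hIJ.mem_closure_tensorSpan hc f)
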